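/- Let $n,p\ge 1$ be integers, let $\mathbb S_p(\mathbb R)$ be the space of real symmetric $p\times p$ matrices, let $\mathbb R[x]_{\le 2n}$ be the space of real polynomials of degree at most $2n$, and let $L:\mathbb R[x]_{\le 2n}\to\mathbb S_p(\mathbb R)$ be a linear map. Put $S_i:=L(x^i)$ for $0\le i\le 2n$, and assume that the block Hankel moment matrix $M(n):=(S_{i+j-2})_{i,j=1}^{n+1}$ is positive definite. A positive $\mathbb S_p(\mathbb R)$-valued measure is a map $\mu=(\mu_{ij})_{i,j=1}^p$ from the Borel sets of $\mathbb R$ to $\mathbb S_p(\mathbb R)$ such that every $\mu_{ij}$ is a (finite) real measure and $\mu(\Delta)$ is positive semidefinite for every Borel set $\Delta$. It is a representing measure for $L$ if every $f\in\mathbb R[x]_{\le 2n}$ is integrable with respect to the trace measure $\sum_{i}\mu_{ii}$ and $L(f)=\int f\,d\mu:=\bigl(\int f\,d\mu_{ij}\bigr)_{i,j=1}^p$. It is finitely atomic if it vanishes on the complement of a finite set. For $x\in\mathbb R$ the multiplicity $\operatorname{mult}_\mu x$ is the rank of the matrix $\mu(\{x\})$ (so it is $0$ if $x$ is not an atom).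 A finitely atomic representing measure $\mu$ for $L$ is minimal if $\sum_{x}\operatorname{mult}_\mu x$ is smallest among all finitely atomic representing measures for $L$. Fix $t\in\mathbb R$ and an integer $m\ge 0$, and let $\mathcal H:=(S_{i+j-1}-tS_{i+j-2})_{i,j=1}^n$. Then the following are equivalent: 1. There exists a minimal representing measure $\mu$ for $L$ such that $\operatorname{mult}_\mu t=m$. 2. $m\le\operatorname{rank}\mathcal H-(n-1)p$. -/

import Mathlib

open MeasureTheory Polynomial
open scoped Matrix

noncomputable section

namespace MatricialQuadrature

/-- The space `𝕊_p(ℝ)` of real symmetric `p × p` matrices. -/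
def SymMat (p : ℕ) : Submodule ℝ (Matrix (Fin p) (Fin p) ℝ) where
  carrier := {A | A.IsSymm}
  add_mem' ha hb := ha.add hb
  zero_mem' := Matrix.isSymm_zero
  smul_mem' c _ ha := ha.smul c

/-- The space `ℝ[x]_{≤ k}` of real polynomials of degree at most `k`. -/
abbrev PolyLE (k : ℕ) : Submodule ℝ ℝ[X] := degreeLE ℝ (k : WithBot ℕ)

section Moments

variable {n p : ℕ} (L : PolyLE (2 * n) →ₗ[ℝ] SymMat p)

/-- The matricial moment `S_i = L(x^i)`, for `i ≤ 2n`. -/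
def moment (i : ℕ) (hi : i ≤ 2 * n) : Matrix (Fin p) (Fin p) ℝ :=
  (L ⟨X ^ i, mem_degreeLE.2 ((degree_X_pow_le i).trans (by exact_mod_cast hi))⟩ :
    Matrix (Fin p) (Fin p) ℝ)

/-- The truncated moment matrix `M(n)`: the `(n+1) × (n+1)` block matrix whose blocks, with block
indices starting at `0`, are `S_{i+j}`. -/
def momentMatrix : Matrix (Fin (n + 1) × Fin p) (Fin (n + 1) × Fin p) ℝ :=
  Matrix.of fun a b => moment L (a.1 + b.1) (by omega) a.2 b.2

/-- The `(x - t)`-localizing matrix `𝓗`: the `n × n` block matrix whose blocks, with block indices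
starting at `0`, are `S_{i+j+1} - t S_{i+j}`. -/
def localizingMatrix (t : ℝ) : Matrix (Fin n × Fin p) (Fin n × Fin p) ℝ :=
  Matrix.of fun a b =>
    (moment L (a.1 + b.1 + 1) (by omega) - t • moment L (a.1 + b.1) (by omega)) a.2 b.2

end Moments

/-- A positive `𝕊_p(ℝ)`-valued Borel measure on `ℝ`: a matrix of (finite) real measures whose value
at every Borel set is positive semidefinite (in particular symmetric). -/
structure MatrixMeasure (p : ℕ) where
  entry : Fin p → Fin p → SignedMeasure ℝ
  posSemidef : ∀ Δ : Set ℝ, MeasurableSet Δ →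
    (Matrix.of fun i j => entry i j Δ).PosSemidef

namespace MatrixMeasure

variable {p : ℕ} (μ : MatrixMeasure p)

/-- The matrix `μ(Δ)`. -/
def value (Δ : Set ℝ) : Matrix (Fin p) (Fin p) ℝ :=
  Matrix.of fun i j => μ.entry i j Δ

/-- The trace measure `τ = ∑ i, μ_ii`. Being nonnegative, it coincides with its variation, which is
how it is turned into an unsigned measure. -/
def traceMeasure : Measure ℝ := (∑ i, μ.entry i i).variation

/-- The entrywise integral `∫ f dμ = (∫ f dμ_ij)_ij`. -/
def integral (f : ℝ → ℝ) : Matrix (Fin p) (Fin p) ℝ :=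
  Matrix.of fun i j => ∫ᵛ x, f x ∂•(μ.entry i j)

/-- `μ` is finitely atomic: it vanishes off a finite set. -/
def IsFinitelyAtomic : Prop := ∃ M : Set ℝ, M.Finite ∧ μ.value Mᶜ = 0

/-- The multiplicity of `x` in `μ`: the rank of the mass `μ({x})`; it is `0` when `x` is not an
atom. -/
def mult (x : ℝ) : ℕ := (μ.value {x}).rank

/-- The sum of the ranks of the masses over all atoms; a finite sum for finitely atomic `μ`, and
used only for those. -/
def rankSum : ℕ := ∑ᶠ x : ℝ, μ.mult x

/-- `μ` represents `L`: every polynomial of degree at most `2n` is `μ`-integrable (that is,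
integrable for the trace measure) and `L(f) = ∫ f dμ`. -/
def IsRepresenting {n : ℕ} (L : PolyLE (2 * n) →ₗ[ℝ] SymMat p) : Prop :=
  ∀ f : PolyLE (2 * n),
    Integrable (fun x => (f : ℝ[X]).eval x) μ.traceMeasure ∧
      (L f : Matrix (Fin p) (Fin p) ℝ) = μ.integral fun x => (f : ℝ[X]).eval x

/-- `μ` is a minimal representing measure for `L`: it is finitely atomic, represents `L`, and has
the smallest sum of ranks of masses among all finitely atomic representing measures. -/
def IsMinimalRepresenting {n : ℕ} (L : PolyLE (2 * n) →ₗ[ℝ] SymMat p) : Prop :=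
  μ.IsFinitelyAtomic ∧ μ.IsRepresenting L ∧
    ∀ ν : MatrixMeasure p, ν.IsFinitelyAtomic → ν.IsRepresenting L → μ.rankSum ≤ ν.rankSum

end MatrixMeasure

end MatricialQuadrature

end

/-! A finitely atomic measure `∑ x, A_x δ_x` represents `L` exactly when the form of the moment
matrix on vector polynomials of degree at most `n` is `(q, r) ↦ ∑ x, q(x)ᵀ A_x r(x)`. As this form
is positive definite, the total rank of the masses is at least `(n + 1) p` (`le_sum_rank`).

Take the form of `M(n)` as the inner product of the space `V` of these polynomials, and let `W` be
the subspace of degree less than `n`. Multiplication by `x - t` is a symmetric operator from `W` to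
`V`, and the form of its compression to `W` has matrix `𝓗`. Every symmetric extension `A` of it to
`V` gives, by the spectral theorem, a representing measure of total rank `(n + 1) p`, hence a
minimal one, in which `t` has multiplicity `dim ker A` (`exists_isRepresenting_of_isSymmetric`).

Write `k = dim ker 𝓗 = n p - rank 𝓗`; the condition on `m` reads `m + k ≤ p`. For the existence,
`ker A` has to be a subspace of `((x - t) W)ᗮ`, a space of dimension `p` that meets `W` in `ker 𝓗`.
A complement of `ker 𝓗` in it has dimension `p - k` and can be made part of the kernel of an
extension; rank one perturbations then lower the dimension of the kernel in steps of one, down to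
`m` (`exists_isSymmetric_eqOn_finrank_ker_eq`). Conversely, for a minimal measure the polynomials
annihilated by the masses outside `t` form a space of dimension at least `mult t` that meets `W`
trivially, and `(x - t) ker 𝓗` is orthogonal to it and to `W`. Counting dimensions gives
`mult t + k ≤ p` (`rank_add_le_rank_localizingMatrix`). -/

noncomputable section

namespace MatricialQuadrature

/-! ### Symmetric extensions of partially defined operators -/

section Extension

open scoped InnerProductSpace

variable {V : Type*} [NormedAddCommGroup V] [InnerProductSpace ℝ V] [FiniteDimensional ℝ V]

/-- An operator that is symmetric on a subspace `W` agrees on `W` with a symmetric operator on the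
whole space. -/
theorem exists_isSymmetric_eqOn (W : Submodule ℝ V) (f : V →ₗ[ℝ] V)
    (hf : ∀ w ∈ W, ∀ w' ∈ W, ⟪f w, w'⟫_ℝ = ⟪w, f w'⟫_ℝ) :
    ∃ A : V →ₗ[ℝ] V, A.IsSymmetric ∧ ∀ w ∈ W, A w = f w := by
  -- With `P` the orthogonal projection onto `W`, take `A = f P + P f* - P f P`.
  have hP : ∀ x y : V, ⟪W.starProjection x, y⟫_ℝ = ⟪x, W.starProjection y⟫_ℝ :=
    fun x y => W.inner_starProjection_left_eq_right x y
  have hPm : ∀ x : V, W.starProjection x ∈ W := fun x => W.starProjection_apply_mem x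
  let P : V →ₗ[ℝ] V := W.starProjection
  have hPd : ∀ x, P x = W.starProjection x := fun _ => rfl
  refine ⟨f ∘ₗ P + P ∘ₗ f.adjoint - P ∘ₗ f ∘ₗ P, fun x y => ?_, fun w hw => ?_⟩
  · simp only [LinearMap.add_apply, LinearMap.sub_apply, LinearMap.comp_apply, hPd, inner_add_left,
      inner_sub_left, inner_add_right, inner_sub_right, hP, LinearMap.adjoint_inner_left]
    rw [← hP x (f.adjoint y), ← hP x (f _), LinearMap.adjoint_inner_right,
      hf _ (hPm x) _ (hPm y)]
    ring
  · have hw' : W.starProjection w = w := W.starProjection_eq_self_iff.2 hw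
    have key : W.starProjection (f.adjoint w) = W.starProjection (f w) := by
      refine ext_inner_right ℝ fun v => ?_
      rw [hP, hP, LinearMap.adjoint_inner_left, ← hf _ hw _ (hPm v)]
    simp [hPd, hw', key]

/-- A rank one perturbation `A + ⟪z, ·⟫ z`, with `z` the component orthogonal to `W` of a vector of
`ker A`, leaves `A` unchanged on `W` and lowers the dimension of the kernel by exactly one. -/
theorem exists_isSymmetric_finrank_ker_add_one (W : Submodule ℝ V) (A : V →ₗ[ℝ] V)
    (hA : A.IsSymmetric) (hW : Disjoint (LinearMap.ker A) W)
    (hpos : 0 < Module.finrank ℝ (LinearMap.ker A)) :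
    ∃ B : V →ₗ[ℝ] V, B.IsSymmetric ∧ (∀ w ∈ W, B w = A w) ∧
      Module.finrank ℝ (LinearMap.ker B) + 1 = Module.finrank ℝ (LinearMap.ker A) := by
  have : Nontrivial (LinearMap.ker A) := Module.finrank_pos_iff.1 hpos
  obtain ⟨⟨u, hu⟩, hu0⟩ := exists_ne (0 : LinearMap.ker A)
  have hu0 : u ≠ 0 := fun h => hu0 (Subtype.ext h)
  have huW : u ∉ W := fun h => hu0 (Submodule.disjoint_def.1 hW u hu h)
  set z : V := u - W.starProjection u with hz
  have hzW : ∀ w ∈ W, ⟪z, w⟫_ℝ = 0 := fun w hw => by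
    rw [real_inner_comm]
    exact (W.mem_orthogonal z).1 (W.sub_starProjection_mem_orthogonal u) w hw
  have hz0 : z ≠ 0 := fun h => huW (by
    rw [sub_eq_zero.1 h]; exact W.starProjection_apply_mem u)
  have hzu : ⟪z, u⟫_ℝ ≠ 0 := by
    have : ⟪z, u⟫_ℝ = ⟪z, z⟫_ℝ := by
      conv_rhs => rw [hz, inner_sub_right, ← hz, hzW _ (W.starProjection_apply_mem u), sub_zero]
    rw [this]
    exact inner_self_ne_zero.2 hz0
  let φ : V →ₗ[ℝ] ℝ := innerₗ V z
  have hφ : ∀ v, φ v = ⟪z, v⟫_ℝ := fun v => rfl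
  refine ⟨A + φ.smulRight z, fun x y => ?_, fun w hw => ?_, ?_⟩
  · simp only [LinearMap.add_apply, LinearMap.smulRight_apply, hφ, inner_add_left, inner_add_right,
      inner_smul_left, inner_smul_right, hA x y, real_inner_comm z x]
    simp [mul_comm]
  · simp [hφ, hzW w hw]
  · have hker : LinearMap.ker (A + φ.smulRight z) =
        (LinearMap.ker (φ.domRestrict (LinearMap.ker A))).map (LinearMap.ker A).subtype := by
      ext v
      simp only [LinearMap.mem_ker, Submodule.mem_map, Submodule.subtype_apply, Subtype.exists,
        LinearMap.domRestrict_apply, exists_and_right, exists_eq_right, LinearMap.add_apply,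
        LinearMap.smulRight_apply]
      refine ⟨fun h => ?_, fun ⟨h1, h2⟩ => by simp [h1, h2]⟩
      -- pairing with `u ∈ ker A` isolates the coefficient of the perturbation
      have h' : ⟪A v + φ v • z, u⟫_ℝ = 0 := by rw [h, inner_zero_left]
      rw [inner_add_left, hA v u, LinearMap.mem_ker.1 hu, inner_zero_right, zero_add,
        real_inner_smul_left] at h'
      have h2 : φ v = 0 := (mul_eq_zero.1 h').resolve_right hzu
      exact ⟨by simpa [h2] using h, h2⟩
    rw [hker, Submodule.finrank_map_subtype_eq]
    refine Module.Dual.finrank_ker_add_one_of_ne_zero fun h => hzu ?_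
    exact LinearMap.congr_fun h (⟨u, hu⟩ : LinearMap.ker A)

/-- The dimension of the kernel of a symmetric operator can be lowered to any prescribed value
without changing the operator on a subspace that avoids the kernel. -/
theorem exists_isSymmetric_finrank_ker_eq (W : Submodule ℝ V) {m : ℕ} (A : V →ₗ[ℝ] V)
    (hA : A.IsSymmetric) (hW : Disjoint (LinearMap.ker A) W)
    (hm : m ≤ Module.finrank ℝ (LinearMap.ker A)) :
    ∃ B : V →ₗ[ℝ] V, B.IsSymmetric ∧ (∀ w ∈ W, B w = A w) ∧
      Module.finrank ℝ (LinearMap.ker B) = m := by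
  obtain ⟨d, hd⟩ := Nat.exists_eq_add_of_le hm
  induction d generalizing A with
  | zero => exact ⟨A, hA, fun _ _ => rfl, hd⟩
  | succ d ih =>
    obtain ⟨B, hB, hBW, hBk⟩ := exists_isSymmetric_finrank_ker_add_one W A hA hW (by omega)
    obtain ⟨C, hC, hCW, hCk⟩ := ih B hB (Submodule.disjoint_def.2 fun x hx hxW =>
      Submodule.disjoint_def.1 hW x (by rwa [LinearMap.mem_ker, ← hBW x hxW]) hxW)
      (by omega) (by omega)
    exact ⟨C, hC, fun w hw => (hCW w hw).trans (hBW w hw), hCk⟩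

/-- Let `f` be symmetric and injective on `W`. The symmetric extensions of `f|_W` to the whole space
attain every kernel dimension up to `dim V - dim W - dim {w ∈ W | f w ⊥ W}`: the kernel of an
extension is contained in `(f W)ᗮ`, which meets `W` in `{w ∈ W | f w ⊥ W}`, and a complement of the
latter in the former can be added to the kernel. -/
theorem exists_isSymmetric_eqOn_finrank_ker_eq (W : Submodule ℝ V) (f : V →ₗ[ℝ] V)
    (hf : ∀ w ∈ W, ∀ w' ∈ W, ⟪f w, w'⟫_ℝ = ⟪w, f w'⟫_ℝ)
    (hinj : ∀ w ∈ W, f w = 0 → w = 0) {m : ℕ}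
    (hm : m + Module.finrank ℝ (W ⊓ Wᗮ.comap f : Submodule ℝ V) + Module.finrank ℝ W ≤
      Module.finrank ℝ V) :
    ∃ A : V →ₗ[ℝ] V, A.IsSymmetric ∧ (∀ w ∈ W, A w = f w) ∧
      Module.finrank ℝ (LinearMap.ker A) = m := by
  set K : Submodule ℝ V := W ⊓ Wᗮ.comap f with hK
  set Q : Submodule ℝ V := (W.map f)ᗮ with hQ
  have hKQ : W ⊓ Q = K := by
    ext v
    simp only [hK, hQ, Submodule.mem_inf, Submodule.mem_comap, Submodule.mem_orthogonal,
      Submodule.mem_map, forall_exists_index, and_imp, forall_apply_eq_imp_iff₂]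
    refine and_congr_right fun hv => forall₂_congr fun w hw => ?_
    rw [hf w hw v hv]
  have hfW : Module.finrank ℝ (W.map f) = Module.finrank ℝ W := by
    have h1 : W.map f = LinearMap.range (f.domRestrict W) := by
      rw [LinearMap.range_domRestrict]
    rw [h1, LinearMap.finrank_range_of_inj]
    refine (injective_iff_map_eq_zero _).2 fun w hw => Subtype.ext (hinj w w.2 hw)
  have hQd : Module.finrank ℝ W + Module.finrank ℝ Q = Module.finrank ℝ V := by
    rw [← hfW]; exact Submodule.finrank_add_finrank_orthogonal _
  obtain ⟨U, hKU, hKUQ⟩ :=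
    IsModularLattice.exists_disjoint_and_sup_eq (show K ≤ Q from hKQ ▸ inf_le_right)
  have hUQ : U ≤ Q := hKUQ ▸ le_sup_right
  have hWU : Disjoint U W := by
    rw [Submodule.disjoint_def]
    intro x hxU hxW
    exact Submodule.disjoint_def.1 hKU x (hKQ ▸ ⟨hxW, hUQ hxU⟩) hxU
  have hUd : m ≤ Module.finrank ℝ U := by
    have h1 := Submodule.finrank_sup_add_finrank_inf_eq K U
    rw [hKUQ, hKU.eq_bot, finrank_bot] at h1
    omega
  -- `g` is `f` on `W` and zero on `U`
  obtain ⟨C, hUC, hC⟩ := hWU.exists_isCompl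
  let g : V →ₗ[ℝ] V := f ∘ₗ W.subtype ∘ₗ W.projectionOnto C hC.symm
  have hgW : ∀ w ∈ W, g w = f w := fun w hw => by
    simp [g, Submodule.projectionOnto_apply_left hC.symm ⟨w, hw⟩]
  have hgU : ∀ u ∈ U, g u = 0 := fun u hu => by
    simp [g, (Submodule.projectionOnto_apply_eq_zero_iff hC.symm).2 (hUC hu)]
  have hfU : ∀ w ∈ W, ∀ u ∈ U, ⟪f w, u⟫_ℝ = 0 := fun w hw u hu =>
    (Submodule.mem_orthogonal _ _).1 (hUQ hu) _ (Submodule.mem_map_of_mem hw)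
  obtain ⟨A, hA, hAg⟩ := exists_isSymmetric_eqOn (W ⊔ U) g (by
    intro x hx y hy
    obtain ⟨w, hw, u, hu, rfl⟩ := Submodule.mem_sup.1 hx
    obtain ⟨w', hw', u', hu', rfl⟩ := Submodule.mem_sup.1 hy
    simp only [map_add, hgW _ hw, hgW _ hw', hgU _ hu, hgU _ hu', add_zero, inner_add_left,
      inner_add_right, hfU _ hw _ hu', hf _ hw _ hw', real_inner_comm _ u, hfU _ hw' _ hu])
  have hAW : ∀ w ∈ W, A w = f w := fun w hw =>
    (hAg w (Submodule.mem_sup_left hw)).trans (hgW w hw)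
  have hUker : U ≤ LinearMap.ker A := fun u hu =>
    (hAg u (Submodule.mem_sup_right hu)).trans (hgU u hu)
  obtain ⟨B, hB, hBW, hBm⟩ := exists_isSymmetric_finrank_ker_eq W A hA
    (Submodule.disjoint_def.2 fun x hx hxW => hinj x hxW (by rwa [← hAW x hxW]))
    (hUd.trans (Submodule.finrank_mono hUker))
  exact ⟨B, hB, fun w hw => (hBW w hw).trans (hAW w hw), hBm⟩

end Extension

/-! ### Vector polynomials and their coefficient vectors -/

section Coefficients

/-- Evaluation at `x` of the vector polynomial `∑ i, q_i x^i` with coefficients `q_i ∈ ℝ^p`,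
`i < k`. Such a polynomial is encoded as the vector `q : Fin k × Fin p → ℝ` of its coefficients,
so that block matrices act on it. -/
def evalAt (k p : ℕ) (x : ℝ) : (Fin k × Fin p → ℝ) →ₗ[ℝ] (Fin p → ℝ) where
  toFun q a := ∑ i : Fin k, x ^ (i : ℕ) * q (i, a)
  map_add' q r := by ext a; simp [mul_add, Finset.sum_add_distrib]
  map_smul' c q := by ext a; simp [Finset.mul_sum, mul_left_comm]

/-- The inclusion of the vector polynomials of degree less than `n` into those of degree at most
`n`. -/
def incl (n p : ℕ) : (Fin n × Fin p → ℝ) →ₗ[ℝ] (Fin (n + 1) × Fin p → ℝ) where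
  toFun c ia := Fin.lastCases (motive := fun _ => ℝ) 0 (fun i => c (i, ia.2)) ia.1
  map_add' c d := by
    ext ⟨i, a⟩
    refine Fin.lastCases ?_ (fun i => ?_) i <;> simp
  map_smul' r c := by
    ext ⟨i, a⟩
    refine Fin.lastCases ?_ (fun i => ?_) i <;> simp

/-- Multiplication by `x`, from the vector polynomials of degree less than `n` to those of degree at
most `n`. -/
def mulX (n p : ℕ) : (Fin n × Fin p → ℝ) →ₗ[ℝ] (Fin (n + 1) × Fin p → ℝ) where
  toFun c ia := Fin.cases (motive := fun _ => ℝ) 0 (fun i => c (i, ia.2)) ia.1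
  map_add' c d := by
    ext ⟨i, a⟩
    refine Fin.cases ?_ (fun i => ?_) i <;> simp
  map_smul' r c := by
    ext ⟨i, a⟩
    refine Fin.cases ?_ (fun i => ?_) i <;> simp

/-- Multiplication by `x - t`, from the vector polynomials of degree less than `n` to those of
degree at most `n`. -/
def mulXSub (n p : ℕ) (t : ℝ) : (Fin n × Fin p → ℝ) →ₗ[ℝ] (Fin (n + 1) × Fin p → ℝ) :=
  mulX n p - t • incl n p

variable {n p : ℕ}

@[simp] theorem incl_castSucc (c : Fin n × Fin p → ℝ) (i : Fin n) (a : Fin p) :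
    incl n p c (i.castSucc, a) = c (i, a) := by simp [incl]

@[simp] theorem incl_last (c : Fin n × Fin p → ℝ) (a : Fin p) :
    incl n p c (Fin.last n, a) = 0 := by simp [incl]

@[simp] theorem mulX_succ (c : Fin n × Fin p → ℝ) (i : Fin n) (a : Fin p) :
    mulX n p c (i.succ, a) = c (i, a) := by simp [mulX]

@[simp] theorem mulX_zero (c : Fin n × Fin p → ℝ) (a : Fin p) :
    mulX n p c (0, a) = 0 := by simp [mulX]

theorem incl_injective : Function.Injective (incl n p) := fun c d h => by
  ext ⟨i, a⟩
  simpa using congrFun h (i.castSucc, a)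

theorem evalAt_incl (x : ℝ) (c : Fin n × Fin p → ℝ) :
    evalAt (n + 1) p x (incl n p c) = evalAt n p x c := by
  ext a
  simp [evalAt, Fin.sum_univ_castSucc]

theorem evalAt_mulXSub (t x : ℝ) (c : Fin n × Fin p → ℝ) :
    evalAt (n + 1) p x (mulXSub n p t c) = (x - t) • evalAt n p x c := by
  have h : evalAt (n + 1) p x (mulX n p c) = x • evalAt n p x c := by
    ext a
    simp [evalAt, Fin.sum_univ_succ, Finset.mul_sum, pow_succ', mul_assoc]
  rw [mulXSub, LinearMap.sub_apply, map_sub, h, LinearMap.smul_apply, map_smul, evalAt_incl,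
    sub_smul]

theorem mulXSub_injective (t : ℝ) : Function.Injective (mulXSub n p t) := by
  rw [injective_iff_map_eq_zero]
  intro c hc
  have h : ∀ x ≠ t, evalAt n p x c = 0 := fun x hx => by
    have := evalAt_mulXSub t x c
    rw [hc, map_zero] at this
    exact (smul_eq_zero.1 this.symm).resolve_left (sub_ne_zero.2 hx)
  -- the polynomial with coefficients `c` vanishes at the `n` points `t + 1, …, t + n`
  ext ⟨i, a⟩
  refine congrFun (Matrix.eq_zero_of_forall_index_sum_mul_pow_eq_zero
    (f := fun j : Fin n => t + 1 + (j : ℕ)) (v := fun i => c (i, a)) (fun j k hjk => ?_)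
    fun j => ?_) i
  · exact Fin.ext (by exact_mod_cast add_left_cancel hjk)
  · have := congrFun (h (t + 1 + (j : ℕ)) (by
      have : (0 : ℝ) ≤ (j : ℕ) := Nat.cast_nonneg _
      linarith)) a
    simpa [evalAt, mul_comm] using this

theorem dotProduct_incl (v : Fin (n + 1) × Fin p → ℝ) (c : Fin n × Fin p → ℝ) :
    v ⬝ᵥ incl n p c = ∑ ia : Fin n × Fin p, v (ia.1.castSucc, ia.2) * c ia := by
  simp [dotProduct, Fintype.sum_prod_type, Fin.sum_univ_castSucc]

theorem dotProduct_mulX (v : Fin (n + 1) × Fin p → ℝ) (c : Fin n × Fin p → ℝ) :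
    v ⬝ᵥ mulX n p c = ∑ ia : Fin n × Fin p, v (ia.1.succ, ia.2) * c ia := by
  simp [dotProduct, Fintype.sum_prod_type, Fin.sum_univ_succ]

/-- The localizing matrix is the matrix of the form `(c, d) ↦ L((x - t) cᵀ d)`. -/
theorem momentMatrix_mulXSub_incl (L : PolyLE (2 * n) →ₗ[ℝ] SymMat p) (t : ℝ)
    (c d : Fin n × Fin p → ℝ) :
    mulXSub n p t c ⬝ᵥ momentMatrix L *ᵥ incl n p d = c ⬝ᵥ localizingMatrix L t *ᵥ d := by
  have h1 : ∀ i, (momentMatrix L *ᵥ incl n p d) i =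
      ∑ jb : Fin n × Fin p, momentMatrix L i (jb.1.castSucc, jb.2) * d jb := fun i =>
    dotProduct_incl _ _
  rw [dotProduct_comm, mulXSub, LinearMap.sub_apply, LinearMap.smul_apply, dotProduct_sub,
    dotProduct_smul, dotProduct_mulX, dotProduct_incl, Finset.smul_sum, ← Finset.sum_sub_distrib]
  refine Finset.sum_congr rfl fun ia _ => ?_
  rw [h1, h1, smul_eq_mul, ← mul_assoc, ← sub_mul, Finset.mul_sum, ← Finset.sum_sub_distrib,
    mul_comm]
  congr 1
  refine Finset.sum_congr rfl fun jb _ => ?_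
  simp only [momentMatrix, localizingMatrix, Matrix.of_apply, Matrix.sub_apply, Matrix.smul_apply,
    smul_eq_mul, Fin.val_succ, Fin.val_castSucc, Nat.add_right_comm _ 1]
  ring

end Coefficients

/-! ### Rank inequalities for atomic representations -/

section Rank

variable {n p : ℕ}

theorem finrank_le_finrank_inf_ker_add {E F : Type*} [AddCommGroup E] [Module ℝ E]
    [FiniteDimensional ℝ E] [AddCommGroup F] [Module ℝ F] (U : Submodule ℝ E) (g : E →ₗ[ℝ] F) :
    Module.finrank ℝ U ≤
      Module.finrank ℝ (U ⊓ LinearMap.ker g : Submodule ℝ E) +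
        Module.finrank ℝ (LinearMap.range g) := by
  rw [← (g.domRestrict U).finrank_range_add_finrank_ker, add_comm]
  refine add_le_add (le_of_eq ?_) (Submodule.finrank_mono ?_)
  · rw [LinearMap.ker_domRestrict, ← Submodule.finrank_map_subtype_eq,
      Submodule.map_comap_subtype]
  · rintro _ ⟨x, rfl⟩
    exact ⟨x, rfl⟩

/-- The space of vector polynomials of degree at most `n` annihilated by all the masses `A x`,
`x ∈ s`. -/
def nullSpace (n : ℕ) (s : Finset ℝ) (A : ℝ → Matrix (Fin p) (Fin p) ℝ) :
    Submodule ℝ (Fin (n + 1) × Fin p → ℝ) :=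
  ⨅ x ∈ s, LinearMap.ker ((A x).mulVecLin ∘ₗ evalAt (n + 1) p x)

theorem mem_nullSpace {s : Finset ℝ} {A : ℝ → Matrix (Fin p) (Fin p) ℝ}
    {q : Fin (n + 1) × Fin p → ℝ} :
    q ∈ nullSpace n s A ↔ ∀ x ∈ s, A x *ᵥ evalAt (n + 1) p x q = 0 := by
  simp [nullSpace]

theorem le_finrank_nullSpace_add (s : Finset ℝ) (A : ℝ → Matrix (Fin p) (Fin p) ℝ) :
    (n + 1) * p ≤ Module.finrank ℝ (nullSpace n s A) + ∑ x ∈ s, (A x).rank := by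
  classical
  induction s using Finset.induction_on with
  | empty =>
    have h : nullSpace n ∅ A = ⊤ := by simp [nullSpace]
    rw [h, finrank_top]
    simp
  | insert x s hx ih =>
    have h := finrank_le_finrank_inf_ker_add (nullSpace n s A)
      ((A x).mulVecLin ∘ₗ evalAt (n + 1) p x)
    have h2 : nullSpace n (insert x s) A =
        nullSpace n s A ⊓ LinearMap.ker ((A x).mulVecLin ∘ₗ evalAt (n + 1) p x) := by
      rw [nullSpace, Finset.iInf_insert, inf_comm]; rfl
    have h3 : Module.finrank ℝ (LinearMap.range ((A x).mulVecLin ∘ₗ evalAt (n + 1) p x)) ≤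
        (A x).rank := Submodule.finrank_mono (LinearMap.range_comp_le_range _ _)
    rw [Finset.sum_insert hx, h2]
    omega

variable {L : PolyLE (2 * n) →ₗ[ℝ] SymMat p} {s : Finset ℝ} {A : ℝ → Matrix (Fin p) (Fin p) ℝ}

theorem dotProduct_pow_mul (k : ℕ) (x : ℝ) (v : Fin k × Fin p → ℝ) (w : Fin p → ℝ) :
    v ⬝ᵥ (fun ia => x ^ (ia.1 : ℕ) * w ia.2) = evalAt k p x v ⬝ᵥ w := by
  simp only [dotProduct, evalAt, LinearMap.coe_mk, AddHom.coe_mk, Fintype.sum_prod_type,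
    Finset.sum_mul]
  rw [Finset.sum_comm]
  exact Finset.sum_congr rfl fun a _ => Finset.sum_congr rfl fun i _ => by ring

theorem localizingMatrix_isSymm (L : PolyLE (2 * n) →ₗ[ℝ] SymMat p) (t : ℝ) :
    (localizingMatrix L t).IsSymm := by
  have h : ∀ (r : ℕ) (hr : r ≤ 2 * n) (a b : Fin p), moment L r hr a b = moment L r hr b a :=
    fun r hr a b => (L _).2.apply b a
  ext ia jb
  simp only [localizingMatrix, Matrix.transpose_apply, Matrix.of_apply, Matrix.sub_apply,
    Matrix.smul_apply, h _ _ jb.2 ia.2, add_comm (jb.1 : ℕ) ia.1]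

/-- For an atomic representation with masses `A x`, the moment matrix is the matrix of the form
`(q, r) ↦ ∑ x, q(x)ᵀ A_x r(x)`. -/
theorem momentMatrix_form
    (hM : ∀ (r : ℕ) (hr : r ≤ 2 * n), moment L r hr = ∑ x ∈ s, x ^ r • A x)
    (q r : Fin (n + 1) × Fin p → ℝ) :
    q ⬝ᵥ momentMatrix L *ᵥ r =
      ∑ x ∈ s, evalAt (n + 1) p x q ⬝ᵥ A x *ᵥ evalAt (n + 1) p x r := by
  have h : momentMatrix L *ᵥ r = ∑ x ∈ s, fun ia : Fin (n + 1) × Fin p =>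
      x ^ (ia.1 : ℕ) * (A x *ᵥ evalAt (n + 1) p x r) ia.2 := by
    ext ia
    have h1 : (fun jb => momentMatrix L ia jb) = ∑ x ∈ s, fun jb : Fin (n + 1) × Fin p =>
        x ^ (jb.1 : ℕ) * (x ^ (ia.1 : ℕ) * A x ia.2 jb.2) := by
      ext jb
      simp [momentMatrix, hM, Matrix.sum_apply, Finset.sum_apply, pow_add, mul_left_comm, mul_assoc]
    rw [Finset.sum_apply]
    change (fun jb => momentMatrix L ia jb) ⬝ᵥ r = _
    rw [dotProduct_comm, h1, dotProduct_sum]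
    refine Finset.sum_congr rfl fun x _ => ?_
    rw [dotProduct_pow_mul _ _ _ fun b => x ^ (ia.1 : ℕ) * A x ia.2 b, dotProduct_comm]
    simp only [Matrix.mulVec, dotProduct, Finset.mul_sum, mul_assoc]
  rw [h, dotProduct_sum]
  exact Finset.sum_congr rfl fun x _ => dotProduct_pow_mul _ _ _ _

theorem eq_zero_of_form_eq_zero (hL : (momentMatrix L).PosDef) {q : Fin (n + 1) × Fin p → ℝ}
    (hq : q ⬝ᵥ momentMatrix L *ᵥ q = 0) : q = 0 := by
  by_contra h
  exact (hL.dotProduct_mulVec_pos h).ne' (by simpa using hq)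

theorem eq_zero_of_mem_nullSpace (hL : (momentMatrix L).PosDef)
    (hM : ∀ (r : ℕ) (hr : r ≤ 2 * n), moment L r hr = ∑ x ∈ s, x ^ r • A x)
    {q : Fin (n + 1) × Fin p → ℝ} (hq : q ∈ nullSpace n s A) : q = 0 := by
  refine eq_zero_of_form_eq_zero hL ?_
  rw [momentMatrix_form hM]
  exact Finset.sum_eq_zero fun x hx => by rw [mem_nullSpace.1 hq x hx, dotProduct_zero]

/-- The masses of an atomic representation have total rank at least the size of the moment
matrix. -/
theorem le_sum_rank (hL : (momentMatrix L).PosDef)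
    (hM : ∀ (r : ℕ) (hr : r ≤ 2 * n), moment L r hr = ∑ x ∈ s, x ^ r • A x) :
    (n + 1) * p ≤ ∑ x ∈ s, (A x).rank := by
  have h : nullSpace n s A = ⊥ :=
    (Submodule.eq_bot_iff _).2 fun q hq => eq_zero_of_mem_nullSpace hL hM hq
  have h' := le_finrank_nullSpace_add (n := n) s A
  rwa [h, finrank_bot, zero_add] at h'

/-- The rank bound at a node `t`. Let `N` be the space of vector polynomials annihilated by all
masses outside `t`; its dimension is at least the rank of the mass at `t`. The polynomials of degree
less than `n`, the space `N`, and `(x - t) ker 𝓗` are linearly independent, because the third space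
is orthogonal to the first two and the first two meet trivially. -/
theorem rank_add_le_rank_localizingMatrix (hL : (momentMatrix L).PosDef) (hA : ∀ x ∉ s, A x = 0)
    (hM : ∀ (r : ℕ) (hr : r ≤ 2 * n), moment L r hr = ∑ x ∈ s, x ^ r • A x)
    (hs : ∑ x ∈ s, (A x).rank ≤ (n + 1) * p) (t : ℝ) :
    (A t).rank + n * p ≤ (localizingMatrix L t).rank + p := by
  classical
  have hsum : ∑ x ∈ s, (A x).rank = (A t).rank + ∑ x ∈ s.erase t, (A x).rank := by
    by_cases ht : t ∈ s
    · exact (Finset.add_sum_erase s _ ht).symm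
    · rw [hA t ht, Matrix.rank_zero, zero_add, Finset.erase_eq_of_notMem ht]
  have hN := le_finrank_nullSpace_add (n := n) (s.erase t) A
  set N := nullSpace n (s.erase t) A
  let H := localizingMatrix L t
  have hH : H.rank + Module.finrank ℝ (LinearMap.ker H.mulVecLin) = n * p := by
    have := H.mulVecLin.finrank_range_add_finrank_ker
    rwa [Module.finrank_fintype_fun_eq_card, Fintype.card_prod, Fintype.card_fin,
      Fintype.card_fin] at this
  have hNmul : ∀ c, incl n p c ∈ N → mulXSub n p t c ∈ nullSpace n s A := fun c hc => by
    rw [mem_nullSpace] at hc ⊢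
    intro x hx
    rw [evalAt_mulXSub, Matrix.mulVec_smul]
    by_cases hxt : x = t
    · simp [hxt]
    · rw [← evalAt_incl, hc x (Finset.mem_erase.2 ⟨hxt, hx⟩), smul_zero]
  have hdisj : Disjoint (LinearMap.range (incl n p)) N := by
    rw [Submodule.disjoint_def]
    rintro _ ⟨c, rfl⟩ hc
    have h0 : mulXSub n p t c = 0 := eq_zero_of_mem_nullSpace hL hM (hNmul c hc)
    rw [mulXSub_injective t (h0.trans (map_zero _).symm), map_zero]
  have hdisj' : Disjoint (LinearMap.range (incl n p) ⊔ N)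
      ((LinearMap.ker H.mulVecLin).map (mulXSub n p t)) := by
    rw [Submodule.disjoint_def]
    rintro _ hq ⟨c, hc, rfl⟩
    obtain ⟨_, ⟨d, rfl⟩, r, hr, hdr⟩ := Submodule.mem_sup.1 hq
    refine eq_zero_of_form_eq_zero hL ?_
    have hc0 : H *ᵥ c = 0 := hc
    have hHs : Hᵀ = H := localizingMatrix_isSymm L t
    have e1 : mulXSub n p t c ⬝ᵥ momentMatrix L *ᵥ incl n p d = 0 := by
      rw [momentMatrix_mulXSub_incl, Matrix.dotProduct_mulVec, ← Matrix.mulVec_transpose]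
      change (Hᵀ *ᵥ c) ⬝ᵥ d = 0
      rw [hHs, hc0, zero_dotProduct]
    have e2 : mulXSub n p t c ⬝ᵥ momentMatrix L *ᵥ r = 0 := by
      rw [momentMatrix_form hM]
      refine Finset.sum_eq_zero fun x hx => ?_
      by_cases hxt : x = t
      · rw [evalAt_mulXSub, hxt, sub_self, zero_smul, zero_dotProduct]
      · rw [mem_nullSpace.1 hr x (Finset.mem_erase.2 ⟨hxt, hx⟩), dotProduct_zero]
    rw [← hdr, Matrix.mulVec_add, dotProduct_add, hdr, e1, e2, add_zero]
  have h1 := Submodule.finrank_add_finrank_le_of_disjoint hdisj'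
  have h2 := Submodule.finrank_sup_add_finrank_inf_eq (LinearMap.range (incl n p)) N
  rw [hdisj.eq_bot, finrank_bot, LinearMap.finrank_range_of_inj incl_injective] at h2
  have h3 : Module.finrank ℝ ((LinearMap.ker H.mulVecLin).map (mulXSub n p t)) =
      Module.finrank ℝ (LinearMap.ker H.mulVecLin) :=
    (Submodule.equivMapOfInjective _ (mulXSub_injective t) _).finrank_eq.symm
  simp only [Module.finrank_fintype_fun_eq_card, Fintype.card_prod, Fintype.card_fin] at h1 h2
  change (A t).rank + n * p ≤ H.rank + p
  have : (n + 1) * p = n * p + p := by ring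
  omega

end Rank

/-! ### Finitely atomic matrix measures -/

section Atomic

open scoped MatrixOrder

theorem integrable_dirac (f : ℝ → ℝ) (x c : ℝ) :
    Integrable f (VectorMeasure.dirac x c : SignedMeasure ℝ).variation := by
  rw [VectorMeasure.variation_dirac]
  exact (MeasureTheory.integrable_dirac (by finiteness)).smul_measure (by finiteness)

theorem integral_sum_dirac {ι : Type*} (s : Finset ι) (x c : ι → ℝ) (f : ℝ → ℝ) :
    ∫ᵛ y, f y ∂•(∑ i ∈ s, VectorMeasure.dirac (x i) (c i) : SignedMeasure ℝ) =
      ∑ i ∈ s, f (x i) * c i := by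
  rw [VectorMeasure.integral_finsetSum_vectorMeasure fun i _ => integrable_dirac f _ _]
  simp

theorem sum_dirac_apply {ι : Type*} (s : Finset ι) (x c : ι → ℝ) {Δ : Set ℝ}
    [DecidablePred (· ∈ Δ)] (hΔ : MeasurableSet Δ) :
    (∑ i ∈ s, VectorMeasure.dirac (x i) (c i) : SignedMeasure ℝ) Δ =
      ∑ i ∈ s with x i ∈ Δ, c i := by
  rw [FunLike.coe_sum, Finset.sum_apply, Finset.sum_filter]
  refine Finset.sum_congr rfl fun i _ => ?_
  by_cases hi : x i ∈ Δ
  · simp [hi, hΔ]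
  · simp [hi]

theorem restrict_finset (v : SignedMeasure ℝ) (s : Finset ℝ) :
    v.restrict (s : Set ℝ) = ∑ x ∈ s, VectorMeasure.dirac x (v {x}) := by
  classical
  induction s using Finset.induction_on with
  | empty => simp
  | insert x s hx ih =>
    rw [Finset.coe_insert, Set.insert_eq, VectorMeasure.restrict_union (by simpa using hx)
      (measurableSet_singleton x) s.measurableSet, ih, VectorMeasure.restrict_singleton,
      Finset.sum_insert hx]

variable {n p : ℕ}

namespace MatrixMeasure

theorem value_eq_zero_of_subset (μ : MatrixMeasure p) {Δ Γ : Set ℝ} (hΔ : MeasurableSet Δ)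
    (hΓ : MeasurableSet Γ) (h : Δ ⊆ Γ) (h0 : μ.value Γ = 0) : μ.value Δ = 0 := by
  have hadd : μ.value Δ + μ.value (Γ \ Δ) = 0 := by
    rw [← h0]
    ext i j
    have := (μ.entry i j).of_union (Set.disjoint_sdiff_right (s := Δ) (t := Γ)) hΔ (hΓ.diff hΔ)
    rw [Set.union_sdiff_cancel h] at this
    exact this.symm
  exact ((add_eq_zero_iff_of_nonneg (μ.posSemidef Δ hΔ).nonneg
    (μ.posSemidef (Γ \ Δ) (hΓ.diff hΔ)).nonneg).1 hadd).1

/-- A finitely atomic matrix measure is the sum of its point masses. -/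
theorem IsFinitelyAtomic.exists_entry_eq {μ : MatrixMeasure p} (h : μ.IsFinitelyAtomic) :
    ∃ s : Finset ℝ, (∀ x ∉ s, μ.value {x} = 0) ∧
      ∀ a b, μ.entry a b = ∑ x ∈ s, VectorMeasure.dirac x (μ.value {x} a b) := by
  obtain ⟨M, hM, h0⟩ := h
  obtain ⟨s, rfl⟩ := hM.exists_finset_coe
  have hs : MeasurableSet (s : Set ℝ) := s.measurableSet
  refine ⟨s, fun x hx => μ.value_eq_zero_of_subset (measurableSet_singleton x) hs.compl
    (by simpa using hx) h0, fun a b => ?_⟩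
  have h1 : (μ.entry a b).restrict (s : Set ℝ)ᶜ = 0 := by
    ext Δ hΔ
    rw [VectorMeasure.restrict_apply _ hs.compl hΔ]
    exact congrFun (congrFun (μ.value_eq_zero_of_subset (hΔ.inter hs.compl) hs.compl
      Set.inter_subset_right h0) a) b
  have h2 := VectorMeasure.restrict_add_restrict_compl (v := μ.entry a b) hs
  rw [h1, add_zero, restrict_finset] at h2
  exact h2.symm

theorem rankSum_eq_sum (μ : MatrixMeasure p) {s : Finset ℝ} (hs : ∀ x ∉ s, μ.value {x} = 0) :
    μ.rankSum = ∑ x ∈ s, (μ.value {x}).rank := by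
  refine finsum_eq_sum_of_support_subset _ fun x hx => ?_
  by_contra hxs
  exact hx (by simp [mult, hs x hxs])

theorem moment_eq_sum {μ : MatrixMeasure p} {L : PolyLE (2 * n) →ₗ[ℝ] SymMat p}
    (hμ : μ.IsRepresenting L) {s : Finset ℝ}
    (hs : ∀ a b, μ.entry a b = ∑ x ∈ s, VectorMeasure.dirac x (μ.value {x} a b)) (r : ℕ)
    (hr : r ≤ 2 * n) : moment L r hr = ∑ x ∈ s, x ^ r • μ.value {x} := by
  rw [moment, (hμ _).2]
  ext a b
  simp [integral, hs a b, integral_sum_dirac, Matrix.sum_apply]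

/-- The measure `∑ ℓ, u_ℓ u_ℓᵀ δ_{x_ℓ}`; the nodes `x_ℓ` need not be distinct. -/
def ofVectors {N : ℕ} (x : Fin N → ℝ) (u : Fin N → Fin p → ℝ) : MatrixMeasure p where
  entry a b := ∑ l, VectorMeasure.dirac (x l) (u l a * u l b)
  posSemidef Δ hΔ := by
    classical
    have h : (Matrix.of fun a b =>
        (∑ l, VectorMeasure.dirac (x l) (u l a * u l b) : SignedMeasure ℝ) Δ) =
        ∑ l with x l ∈ Δ, Matrix.vecMulVec (u l) (star (u l)) := by
      ext a b
      simp [sum_dirac_apply _ _ _ hΔ, Matrix.sum_apply, Matrix.vecMulVec_apply]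
    rw [h]
    exact Matrix.posSemidef_sum _ fun l _ => Matrix.posSemidef_vecMulVec_self_star _

section ofVectors

variable {N : ℕ} (x : Fin N → ℝ) (u : Fin N → Fin p → ℝ)

theorem value_ofVectors {Δ : Set ℝ} [DecidablePred (· ∈ Δ)] (hΔ : MeasurableSet Δ) :
    (ofVectors x u).value Δ = ∑ l with x l ∈ Δ, Matrix.vecMulVec (u l) (u l) := by
  ext a b
  simp [value, ofVectors, sum_dirac_apply _ _ _ hΔ, Matrix.sum_apply, Matrix.vecMulVec_apply]

theorem isFinitelyAtomic_ofVectors : (ofVectors x u).IsFinitelyAtomic := by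
  classical
  refine ⟨Set.range x, Set.finite_range x, ?_⟩
  rw [value_ofVectors _ _ (Set.finite_range x).measurableSet.compl]
  simp

theorem isRepresenting_ofVectors {L : PolyLE (2 * n) →ₗ[ℝ] SymMat p}
    (hM : ∀ (r : ℕ) (hr : r ≤ 2 * n),
      moment L r hr = ∑ l, x l ^ r • Matrix.vecMulVec (u l) (u l)) :
    (ofVectors x u).IsRepresenting L := by
  intro f
  constructor
  · rw [traceMeasure]
    refine VectorMeasure.Integrable.finsetSum_vectorMeasure fun a _ => ?_
    exact VectorMeasure.Integrable.finsetSum_vectorMeasure fun l _ => integrable_dirac _ _ _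
  · have hf : f = ∑ r : Fin (2 * n + 1), (f : ℝ[X]).coeff r •
        (⟨X ^ (r : ℕ), mem_degreeLE.2 ((degree_X_pow_le (r : ℕ)).trans
          (by exact_mod_cast Nat.lt_succ_iff.1 r.2))⟩ : PolyLE (2 * n)) := by
      refine Subtype.ext ?_
      have hd : (f : ℝ[X]).natDegree < 2 * n + 1 :=
        Nat.lt_succ_iff.2 (natDegree_le_iff_degree_le.2 (mem_degreeLE.1 f.2))
      conv_lhs => rw [(f : ℝ[X]).as_sum_range' _ hd, Finset.sum_range]
      simp [smul_X_eq_monomial]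
    have hLf : (L f : Matrix (Fin p) (Fin p) ℝ) =
        ∑ r : Fin (2 * n + 1), (f : ℝ[X]).coeff r • moment L r (Nat.lt_succ_iff.1 r.2) := by
      conv_lhs => rw [hf, map_sum]
      simp only [map_smul, moment, Submodule.coe_sum, Submodule.coe_smul]
    ext a b
    rw [hLf]
    simp only [integral, Matrix.of_apply, ofVectors, integral_sum_dirac, hM, Matrix.sum_apply,
      Matrix.smul_apply, smul_eq_mul, Matrix.vecMulVec_apply, Finset.mul_sum]
    rw [Finset.sum_comm]
    refine Finset.sum_congr rfl fun l _ => ?_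
    have hd : (f : ℝ[X]).natDegree < 2 * n + 1 :=
      Nat.lt_succ_iff.2 (natDegree_le_iff_degree_le.2 (mem_degreeLE.1 f.2))
    rw [eval_eq_sum_range' hd, Finset.sum_range, Finset.sum_mul]
    exact Finset.sum_congr rfl fun r _ => by ring

theorem mult_ofVectors_le [DecidableEq ℝ] (y : ℝ) :
    (ofVectors x u).mult y ≤ Finset.card {l | x l = y} := by
  classical
  -- the mass at `y` is `BᵀB`, the rows of `B` being the vectors located at `y`
  let B : Matrix {l // x l = y} (Fin p) ℝ := Matrix.of fun l => u l
  have hB : (ofVectors x u).value {y} = Bᵀ * B := by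
    rw [value_ofVectors _ _ (measurableSet_singleton y)]
    ext a b
    simp only [Matrix.sum_apply, Matrix.vecMulVec_apply, Matrix.mul_apply, Set.mem_singleton_iff]
    exact Finset.sum_subtype _ (by simp) _
  rw [mult, hB, ← Fintype.card_subtype]
  exact (Matrix.rank_mul_le_left _ _).trans (Matrix.rank_le_card_width _)

/-- If the atoms of `∑ ℓ, u_ℓ u_ℓᵀ δ_{x_ℓ}`, with `N` terms, have total rank at least `N`, then the
total rank is `N`, and each multiplicity is the number of terms located at the point. -/
theorem mult_ofVectors_eq [DecidableEq ℝ] (hN : N ≤ (ofVectors x u).rankSum) :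
    (ofVectors x u).rankSum = N ∧
      ∀ y, (ofVectors x u).mult y = Finset.card {l | x l = y} := by
  have hz : ∀ y ∉ Finset.univ.image x, (ofVectors x u).mult y = 0 := fun y hy => by
    refine Nat.le_zero.1 ((mult_ofVectors_le x u y).trans (le_of_eq ?_))
    rw [Finset.card_eq_zero, Finset.filter_eq_empty_iff]
    exact fun l _ h => hy (h ▸ Finset.mem_image_of_mem x (Finset.mem_univ l))
  have hsum : (ofVectors x u).rankSum = ∑ y ∈ Finset.univ.image x, (ofVectors x u).mult y :=
    finsum_eq_sum_of_support_subset _ fun y hy => by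
      by_contra h
      exact hy (hz y h)
  have hcard : N = ∑ y ∈ Finset.univ.image x, Finset.card {l | x l = y} := by
    conv_lhs => rw [← Fintype.card_fin N, ← Finset.card_univ,
      Finset.card_eq_sum_card_image x]
  have hle := Finset.sum_le_sum fun y (_ : y ∈ Finset.univ.image x) => mult_ofVectors_le x u y
  rw [← hcard, ← hsum] at hle
  have heq := le_antisymm hle hN
  refine ⟨heq, fun y => ?_⟩
  by_cases hy : y ∈ Finset.univ.image x
  · have h := heq.trans hcard
    rw [hsum] at h
    exact (Finset.sum_eq_sum_iff_of_le fun y _ => mult_ofVectors_le x u y).1 h y hy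
  · rw [hz y hy, eq_comm, Finset.card_eq_zero, Finset.filter_eq_empty_iff]
    exact fun l _ h => hy (h ▸ Finset.mem_image_of_mem x (Finset.mem_univ l))

end ofVectors

end MatrixMeasure

end Atomic

/-! ### Quadrature rules from symmetric extensions of multiplication -/

section Construction

open scoped InnerProductSpace MatrixOrder

/-- A positive definite form is isometric to the Euclidean one. -/
theorem exists_equiv_inner_eq {ι : Type*} [Fintype ι] {M : Matrix ι ι ℝ} (hM : M.PosDef) :
    ∃ Φ : (ι → ℝ) ≃ₗ[ℝ] EuclideanSpace ℝ ι, ∀ q r, ⟪Φ q, Φ r⟫_ℝ = q ⬝ᵥ M *ᵥ r := by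
  classical
  obtain ⟨B, hB⟩ := CStarAlgebra.nonneg_iff_eq_star_mul_self.mp hM.posSemidef.nonneg
  let Φ : (ι → ℝ) →ₗ[ℝ] EuclideanSpace ℝ ι :=
    (WithLp.linearEquiv 2 ℝ (ι → ℝ)).symm.toLinearMap ∘ₗ B.mulVecLin
  have hΦ : ∀ q r, ⟪Φ q, Φ r⟫_ℝ = q ⬝ᵥ M *ᵥ r := fun q r => by
    have h1 : ⟪Φ q, Φ r⟫_ℝ = (B *ᵥ r) ⬝ᵥ (B *ᵥ q) := rfl
    rw [h1, hB, Matrix.star_eq_conjTranspose, Matrix.conjTranspose_eq_transpose_of_trivial,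
      ← Matrix.mulVec_mulVec, Matrix.dotProduct_mulVec q, Matrix.vecMul_transpose, dotProduct_comm]
  have hinj : Function.Injective Φ := (injective_iff_map_eq_zero _).2 fun q hq => by
    by_contra h
    refine (hM.dotProduct_mulVec_pos h).ne' ?_
    rw [star_trivial, ← hΦ, hq, inner_zero_left]
  exact ⟨LinearEquiv.ofInjectiveOfFinrankEq Φ hinj (by simp), hΦ⟩

variable {n p : ℕ} {L : PolyLE (2 * n) →ₗ[ℝ] SymMat p}

/-- A symmetric operator `A` that extends multiplication by `x - t` (in coordinates `Φ` in which the
form of the moment matrix is the Euclidean one) yields a representing measure: its atoms are the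
numbers `t + λ` for the eigenvalues `λ` of `A`, and its masses are the compressions of the spectral
projections to the constant polynomials. -/
theorem exists_isRepresenting_of_isSymmetric (hL : (momentMatrix L).PosDef) {t : ℝ}
    (Φ : (Fin (n + 1) × Fin p → ℝ) ≃ₗ[ℝ] EuclideanSpace ℝ (Fin (n + 1) × Fin p))
    (hΦ : ∀ q r, ⟪Φ q, Φ r⟫_ℝ = q ⬝ᵥ momentMatrix L *ᵥ r)
    (A : EuclideanSpace ℝ (Fin (n + 1) × Fin p) →ₗ[ℝ] EuclideanSpace ℝ (Fin (n + 1) × Fin p))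
    (hA : A.IsSymmetric) (hext : ∀ c, A (Φ (incl n p c)) = Φ (mulXSub n p t c)) :
    ∃ μ : MatrixMeasure p, μ.IsFinitelyAtomic ∧ μ.IsRepresenting L ∧
      μ.rankSum = (n + 1) * p ∧ μ.mult t = Module.finrank ℝ (LinearMap.ker A) := by
  classical
  have hfin : Module.finrank ℝ (EuclideanSpace ℝ (Fin (n + 1) × Fin p)) = (n + 1) * p := by simp
  let b := hA.eigenvectorBasis hfin
  let x : Fin ((n + 1) * p) → ℝ := fun l => hA.eigenvalues hfin l + t
  let u : Fin ((n + 1) * p) → Fin p → ℝ := fun l a => ⟪b l, Φ (Pi.single (0, a) 1)⟫_ℝ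
  have hstep : ∀ l c, ⟪b l, Φ (mulX n p c)⟫_ℝ = x l * ⟪b l, Φ (incl n p c)⟫_ℝ := fun l c => by
    have h1 : mulX n p c = mulXSub n p t c + t • incl n p c := by simp [mulXSub]
    have h2 : A (b l) = hA.eigenvalues hfin l • b l := hA.apply_eigenvectorBasis hfin l
    rw [h1, map_add, map_smul, ← hext, inner_add_right, ← hA, h2, real_inner_smul_left,
      real_inner_smul_right]
    ring
  have hpow : ∀ l a (i : Fin (n + 1)),
      ⟪b l, Φ (Pi.single (i, a) 1)⟫_ℝ = x l ^ (i : ℕ) * u l a := fun l a i => by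
    induction i using Fin.induction with
    | zero => simp [u]
    | succ i ih =>
      have h1 : mulX n p (Pi.single (i, a) 1) = Pi.single (i.succ, a) 1 := by
        ext ⟨j, a'⟩
        refine Fin.cases ?_ (fun j => ?_) j
        · simp [(Fin.succ_ne_zero i).symm]
        · simp [Pi.single_apply]
      have h2 : incl n p (Pi.single (i, a) 1) = Pi.single (i.castSucc, a) 1 := by
        ext ⟨j, a'⟩
        refine Fin.lastCases ?_ (fun j => ?_) j
        · simp [(Fin.castSucc_ne_last i).symm]
        · simp [Pi.single_apply]
      rw [← h1, hstep, h2, ih, Fin.val_succ, pow_succ', mul_assoc, Fin.val_castSucc]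
  have hM : ∀ (r : ℕ) (hr : r ≤ 2 * n),
      moment L r hr = ∑ l, x l ^ r • Matrix.vecMulVec (u l) (u l) := fun r hr => by
    obtain ⟨i, j, rfl⟩ : ∃ i j : Fin (n + 1), r = (i : ℕ) + j :=
      ⟨⟨min r n, by omega⟩, ⟨r - min r n, by omega⟩, by simp⟩
    ext a a'
    have h1 : moment L (i + j) hr a a' =
        ⟪Φ (Pi.single (i, a) 1), Φ (Pi.single (j, a') 1)⟫_ℝ := by
      rw [hΦ, Matrix.mulVec_single_one, single_one_dotProduct]
      rfl
    rw [h1, ← b.sum_inner_mul_inner, Matrix.sum_apply]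
    refine Finset.sum_congr rfl fun l _ => ?_
    rw [real_inner_comm, hpow, hpow, Matrix.smul_apply, Matrix.vecMulVec_apply, smul_eq_mul]
    ring
  set μ := MatrixMeasure.ofVectors x u with hμ
  have hat : μ.IsFinitelyAtomic := MatrixMeasure.isFinitelyAtomic_ofVectors x u
  have hrep : μ.IsRepresenting L := MatrixMeasure.isRepresenting_ofVectors x u hM
  obtain ⟨s, hs, hentry⟩ := hat.exists_entry_eq
  have hle := le_sum_rank hL (MatrixMeasure.moment_eq_sum hrep hentry)
  rw [← μ.rankSum_eq_sum hs] at hle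
  obtain ⟨hsum, hmult⟩ := MatrixMeasure.mult_ofVectors_eq x u hle
  refine ⟨μ, hat, hrep, hsum, ?_⟩
  have hcard := hA.card_filter_eigenvalues_eq hfin (0 : ℝ)
  rw [Module.End.eigenspace_zero] at hcard
  rw [hμ, hmult, ← hcard]
  simp [x]

/-- Multiplication by `x - t`, transported to a space with the inner product of the moment matrix:
it is symmetric and injective on the polynomials of degree less than `n`, and the kernel of its
compression to these has the dimension of `ker 𝓗`. -/
theorem exists_multiplication (t : ℝ)
    (Φ : (Fin (n + 1) × Fin p → ℝ) ≃ₗ[ℝ] EuclideanSpace ℝ (Fin (n + 1) × Fin p))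
    (hΦ : ∀ q r, ⟪Φ q, Φ r⟫_ℝ = q ⬝ᵥ momentMatrix L *ᵥ r) :
    ∃ (W : Submodule ℝ (EuclideanSpace ℝ (Fin (n + 1) × Fin p)))
      (f : EuclideanSpace ℝ (Fin (n + 1) × Fin p) →ₗ[ℝ] EuclideanSpace ℝ (Fin (n + 1) × Fin p)),
      (∀ c, Φ (incl n p c) ∈ W) ∧ (∀ c, f (Φ (incl n p c)) = Φ (mulXSub n p t c)) ∧
      (∀ w ∈ W, ∀ w' ∈ W, ⟪f w, w'⟫_ℝ = ⟪w, f w'⟫_ℝ) ∧ (∀ w ∈ W, f w = 0 → w = 0) ∧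
      Module.finrank ℝ W = n * p ∧
      Module.finrank ℝ (W ⊓ Wᗮ.comap f : Submodule ℝ (EuclideanSpace ℝ (Fin (n + 1) × Fin p))) +
        (localizingMatrix L t).rank ≤ n * p := by
  set H := localizingMatrix L t with hH
  let ψ := Φ.toLinearMap ∘ₗ incl n p
  have hψ : Function.Injective ψ := Φ.injective.comp incl_injective
  obtain ⟨g, hg⟩ := LinearMap.exists_leftInverse_of_injective ψ (LinearMap.ker_eq_bot.2 hψ)
  have hf : ∀ c, (Φ.toLinearMap ∘ₗ mulXSub n p t ∘ₗ g) (ψ c) = Φ (mulXSub n p t c) := fun c => by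
    have : g (ψ c) = c := LinearMap.congr_fun hg c
    simp [this]
  have hform : ∀ c d, ⟪Φ (mulXSub n p t c), ψ d⟫_ℝ = c ⬝ᵥ H *ᵥ d := fun c d =>
    (hΦ _ _).trans (momentMatrix_mulXSub_incl L t c d)
  have hHs : Hᵀ = H := localizingMatrix_isSymm L t
  have hsymm : ∀ c d, c ⬝ᵥ H *ᵥ d = d ⬝ᵥ H *ᵥ c := fun c d => by
    rw [Matrix.dotProduct_mulVec, ← Matrix.mulVec_transpose, hHs, dotProduct_comm]
  refine ⟨LinearMap.range ψ, Φ.toLinearMap ∘ₗ mulXSub n p t ∘ₗ g, fun c => ⟨c, rfl⟩, hf,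
    ?_, ?_, ?_, ?_⟩
  · rintro _ ⟨c, rfl⟩ _ ⟨d, rfl⟩
    rw [hf, hf, hform, real_inner_comm, hform, hsymm]
  · rintro _ ⟨c, rfl⟩ hc
    rw [hf, LinearEquiv.map_eq_zero_iff] at hc
    rw [mulXSub_injective t (hc.trans (map_zero _).symm), map_zero]
  · rw [LinearMap.finrank_range_of_inj hψ]
    simp
  · have hle : LinearMap.range ψ ⊓ (LinearMap.range ψ)ᗮ.comap
        (Φ.toLinearMap ∘ₗ mulXSub n p t ∘ₗ g) ≤ (LinearMap.ker H.mulVecLin).map ψ := by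
      rintro _ ⟨⟨c, rfl⟩, hc⟩
      refine Submodule.mem_map_of_mem ?_
      rw [SetLike.mem_coe, Submodule.mem_comap, hf, Submodule.mem_orthogonal] at hc
      refine dotProduct_eq_zero _ fun d => ?_
      rw [Matrix.mulVecLin_apply, dotProduct_comm, hsymm, ← hform, real_inner_comm]
      exact hc _ ⟨d, rfl⟩
    have h1 := (Submodule.finrank_mono hle).trans (Submodule.finrank_map_le _ _)
    have h2 := H.mulVecLin.finrank_range_add_finrank_ker
    rw [Module.finrank_fintype_fun_eq_card, Fintype.card_prod, Fintype.card_fin,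
      Fintype.card_fin] at h2
    change _ + Module.finrank ℝ (LinearMap.range H.mulVecLin) ≤ _
    omega

end Construction

end MatricialQuadrature

end

/-! ### Multiplicities of a prescribed node in minimal measures -/

open MatricialQuadrature in
theorem theorem1p1 (n p : ℕ) (hn : 1 ≤ n) (hp : 1 ≤ p)
    (L : MatricialQuadrature.PolyLE (2 * n) →ₗ[ℝ] MatricialQuadrature.SymMat p)
    (hL : (MatricialQuadrature.momentMatrix L).PosDef) (t : ℝ) (m : ℕ) :
    (∃ μ : MatricialQuadrature.MatrixMeasure p, μ.IsMinimalRepresenting L ∧ μ.mult t = m) ↔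
      (m : ℤ) ≤ ((MatricialQuadrature.localizingMatrix L t).rank : ℤ) - ((n : ℤ) - 1) * (p : ℤ) := by
  have hint : (m : ℤ) ≤ ((localizingMatrix L t).rank : ℤ) - ((n : ℤ) - 1) * (p : ℤ) ↔
      m + n * p ≤ (localizingMatrix L t).rank + p := by
    rw [sub_mul, one_mul]
    zify
    constructor <;> intro h <;> linarith
  rw [hint]
  obtain ⟨Φ, hΦ⟩ := exists_equiv_inner_eq hL
  obtain ⟨W, f, hW, hfW, hsymm, hinj, hWd, hK⟩ := exists_multiplication t Φ hΦ
  constructor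
  · rintro ⟨μ, ⟨hat, hrep, hmin⟩, rfl⟩
    -- any symmetric extension of multiplication bounds the total rank of a minimal measure
    obtain ⟨A, hA, hAf⟩ := exists_isSymmetric_eqOn W f hsymm
    obtain ⟨ν, hνat, hνrep, hνsum, -⟩ := exists_isRepresenting_of_isSymmetric hL Φ hΦ A hA
      fun c => (hAf _ (hW c)).trans (hfW c)
    obtain ⟨s, hs, hentry⟩ := hat.exists_entry_eq
    refine rank_add_le_rank_localizingMatrix hL (A := fun x => μ.value {x}) hs
      (MatrixMeasure.moment_eq_sum hrep hentry) ?_ t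
    rw [← μ.rankSum_eq_sum hs, ← hνsum]
    exact hmin ν hνat hνrep
  · intro hm
    have hV : Module.finrank ℝ (EuclideanSpace ℝ (Fin (n + 1) × Fin p)) = n * p + p := by
      simp [add_mul]
    obtain ⟨A, hA, hAf, hAm⟩ := exists_isSymmetric_eqOn_finrank_ker_eq W f hsymm hinj (m := m)
      (by omega)
    obtain ⟨μ, hat, hrep, hsum, hmult⟩ := exists_isRepresenting_of_isSymmetric hL Φ hΦ A hA
      fun c => (hAf _ (hW c)).trans (hfW c)
    refine ⟨μ, ⟨hat, hrep, fun ν hνat hνrep => ?_⟩, hmult.trans hAm⟩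
    obtain ⟨s, hs, hentry⟩ := hνat.exists_entry_eq
    rw [hsum, ν.rankSum_eq_sum hs]
    exact le_sum_rank hL (MatrixMeasure.moment_eq_sum hνrep hentry)
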